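/- Let $n\ge 1$ and let $\mathbb R_n$ be the real Clifford algebra over the imaginary units $e_1,\dots,e_n$ ($e_i^2=-1$, $e_ie_j=-e_je_i$ for $i\ne j$), with the Euclidean norm $|\sum_A y_Ae_A|=(\sum_A|y_A|^2)^{1/2}$. For $x=(x_0,\dots,x_n)\in\mathbb R^{n+1}$ put $\underline x=\sum_{i=1}^n x_ie_i$. A function $f:\mathbb R^{n+1}\to\mathbb R_n$ is entire left monogenic if it is of class $C^1$ and $\partial_{x_0}f+\sum_{i=1}^n e_i\partial_{x_i}f=0$ on $\mathbb R^{n+1}$. For $\sigma>0$ let $A_{1,\sigma}$ be the space of entire left monogenic $f$ with $\|f\|_{1,\sigma}:=\sup_{x}|f(x)|e^{-\sigma|x|}<\infty$. A sequence $f_N$ converges to $f$ in $A_1$ if for some $\sigma>0$ all the $f_N$ and $f$ belong to $A_{1,\sigma}$ and $\|f_N-f\|_{1,\sigma}\to0$. For $m\in\mathbb N_0^n$ write $|m|=m_1+\dots+m_n$ and $m!=m_1!\cdots m_n!$. Let $W(m)$ be the set of words $w=(w_1,\dots,w_{|m|})$ in $\{1,\dots,n\}$ in which each $i$ occurs exactly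 $m_i$ times, and let $z_i=x_i-x_0e_i$. Put $$P_m(x)=\frac{m!}{|m|!}\sum_{w\in W(m)}z_{w_1}\cdots z_{w_{|m|}},\qquad e'_m=\sum_{w\in W(m)}e_{w_1}\cdots e_{w_{|m|}},\qquad E(x)=\sum_{k=0}^\infty\frac1{k!}\sum_{|m|=k}P_m(x)\,e'_m ,$$ so that $E$ is the monogenic exponential, the entire left monogenic extension of $e^{\underline x}=\sum_{k\ge0}\underline x^k/k!$. **Theorem.** Let $a\in\mathbb R$ with $|a|>1$, and let $h_j(N)\in\mathbb R$ and $Z_j(N,a)\in\mathbb R_n$ for $0\le j\le N$, $N\in\mathbb N_0$. Suppose that $\sum_{j=0}^N e^{h_j(N)\underline x}Z_j(N,a)$ is a superoscillating sequence, that is, $|h_j(N)|\le1$ for all $j\le N$ and, for some continuous $g:\mathbb R\to\mathbb R$ with $|g(a)|>1$, it converges to $e^{g(a)\underline x}$ as $N\to\infty$, uniformly on every compact subset of $\mathbb R^n$. Suppose further that the sequence $$f_N(x,a)=\sum_{j=0}^N E(h_j(N)x)\,Z_j(N,a)$$ converges to $E(ax)$ in $A_1$. Then, for every entire left monogenic function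 $G$, the sequence $$F_N(x,a)=\sum_{j=0}^N Z_j(N,a)\,G(h_j(N)x)$$ has the supershift property: $\lim_{N\to\infty}F_N(x,a)=G(ax)$ uniformly on every compact subset of $\mathbb R^{n+1}$. -/

import Mathlib

open Filter Topology
open scoped Nat BigOperators

noncomputable section

namespace CliffordSupershift

/-! ### The real Clifford algebra `ℝ_n` and its Euclidean norm -/

/-- The negative definite quadratic form `v ↦ -(v₁² + ⋯ + vₙ²)` on `ℝⁿ`. -/
def negSq (n : ℕ) : QuadraticForm ℝ (Fin n → ℝ) :=
  QuadraticMap.weightedSumSquares ℝ (fun _ : Fin n => (-1 : ℝ))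

/-- The real Clifford algebra `ℝ_n` over the imaginary units `e₁, …, eₙ`, where
`eᵢ² = -1` and `eᵢ eⱼ = -eⱼ eᵢ` for `i ≠ j`. -/
abbrev Cl (n : ℕ) : Type := CliffordAlgebra (negSq n)

/-- The imaginary unit `eᵢ` (indices are shifted by one: `i = 0, …, n - 1`). -/
def imUnit {n : ℕ} (i : Fin n) : Cl n := CliffordAlgebra.ι (negSq n) (Pi.single i 1)

/-- The basis `(e_A)`, `A ⊆ {1, …, n}`, of `ℝ_n`; see `cliffordBasis_apply`. -/
def cliffordBasis (n : ℕ) : Module.Basis (Finset (Fin n)) ℝ (Cl n) :=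
  (Pi.basisFun ℝ (Fin n)).ExteriorAlgebra.map (CliffordAlgebra.equivExterior (negSq n)).symm

theorem contract_prod {n : ℕ} (i : Fin n) (l : List (Fin n)) (hi : i ∉ l) :
    CliffordAlgebra.contractLeft
      ((QuadraticMap.associated (R := ℝ) (-negSq n)) (Pi.single i 1))
      ((l.map fun j => ExteriorAlgebra.ι ℝ (Pi.single j (1 : ℝ) : Fin n → ℝ)).prod) = 0 := by
  induction l with
  | nil => simp
  | cons j l ih =>
    simp only [List.mem_cons, not_or] at hi
    have h0 : (QuadraticMap.associated (R := ℝ) (-negSq n)) (Pi.single i 1)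
        (Pi.single j (1 : ℝ)) = 0 := by
      simp [QuadraticMap.associated_apply, negSq, QuadraticMap.weightedSumSquares_apply,
        Pi.single_apply, Finset.sum_add_distrib, mul_add, hi.1, Ne.symm hi.1]
    rw [List.map_cons, List.prod_cons]
    have := CliffordAlgebra.contractLeft_ι_mul (Q := (0 : QuadraticForm ℝ (Fin n → ℝ)))
      (d := (QuadraticMap.associated (R := ℝ) (-negSq n)) (Pi.single i 1)) (Pi.single j 1)
      ((l.map fun j => ExteriorAlgebra.ι ℝ (Pi.single j (1 : ℝ) : Fin n → ℝ)).prod)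
    refine this.trans ?_
    rw [h0, ih hi.2]
    simp

theorem equivExterior_prod {n : ℕ} (l : List (Fin n)) (hl : l.Nodup) :
    CliffordAlgebra.equivExterior (negSq n) (l.map imUnit).prod =
      (l.map fun j => ExteriorAlgebra.ι ℝ (Pi.single j (1 : ℝ) : Fin n → ℝ)).prod := by
  induction l with
  | nil => simp
  | cons j l ih =>
    rw [List.nodup_cons] at hl
    rw [List.map_cons, List.prod_cons, List.map_cons, List.prod_cons, ← ih hl.2]
    refine (CliffordAlgebra.changeForm_ι_mul
      (CliffordAlgebra.changeForm.associated_neg_proof (Q := negSq n)) _ _).trans ?_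
    have h1 := ih hl.2
    simp only [CliffordAlgebra.equivExterior, CliffordAlgebra.changeFormEquiv_apply] at h1 ⊢
    rw [h1, contract_prod j l hl.1, sub_zero]

/-- `e_A = e_{i₁} ⋯ e_{i_r}` for `A = {i₁ < ⋯ < i_r}`. -/
theorem cliffordBasis_apply (n : ℕ) (A : Finset (Fin n)) :
    cliffordBasis n A = ((A.sort (· ≤ ·)).map imUnit).prod := by
  rw [cliffordBasis, Module.Basis.map_apply, LinearEquiv.symm_apply_eq,
    equivExterior_prod _ (A.sort_nodup _), ExteriorAlgebra.basis_apply]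
  refine (ExteriorAlgebra.ιMulti_apply (R := ℝ) _).trans ?_
  rw [← Finset.listMap_orderEmbOfFin_finRange A rfl, List.map_map, ← List.ofFn_eq_map]
  congr 2
  ext r
  simp [Pi.basisFun_apply]
  rfl

/-- The coordinates `(y_A)` of `y = ∑_A y_A e_A`, in a Euclidean space. -/
def cliffordCoord (n : ℕ) : Cl n ≃ₗ[ℝ] EuclideanSpace ℝ (Finset (Fin n)) :=
  (cliffordBasis n).equivFun.trans (WithLp.linearEquiv 2 ℝ (Finset (Fin n) → ℝ)).symm

/-- The Euclidean norm `|y| = (∑_A |y_A|²)^{1/2}` on `ℝ_n`. -/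
instance instNormedAddCommGroupCl (n : ℕ) : NormedAddCommGroup (Cl n) :=
  NormedAddCommGroup.induced (Cl n) (EuclideanSpace ℝ (Finset (Fin n))) (cliffordCoord n)
    (cliffordCoord n).injective

instance instNormedSpaceCl (n : ℕ) : NormedSpace ℝ (Cl n) :=
  NormedSpace.induced ℝ (Cl n) (EuclideanSpace ℝ (Finset (Fin n))) (cliffordCoord n)

/-! ### Monogenic functions -/

/-- `ℝ^{n+1}` with the Euclidean norm; the coordinate `x 0` is `x₀` and `x i.succ` is the
coordinate of `eᵢ`. -/
abbrev Para (n : ℕ) : Type := EuclideanSpace ℝ (Fin (n + 1))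

/-- The partial derivative `∂f/∂x_i`, `i = 0, …, n`. -/
def pderiv {n : ℕ} (i : Fin (n + 1)) (f : Para n → Cl n) (x : Para n) : Cl n :=
  fderiv ℝ f x (EuclideanSpace.single i 1)

/-- The generalized Cauchy-Riemann operator `D f = ∂₀ f + ∑ᵢ eᵢ ∂ᵢ f`. -/
def cauchyRiemann {n : ℕ} (f : Para n → Cl n) (x : Para n) : Cl n :=
  pderiv 0 f x + ∑ i : Fin n, imUnit i * pderiv i.succ f x

/-- Entire left monogenic functions. -/
def EntireMonogenic {n : ℕ} (f : Para n → Cl n) : Prop :=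
  ContDiff ℝ 1 f ∧ ∀ x, cauchyRiemann f x = 0

/-! ### The space `A₁` of entire monogenic functions of exponential growth -/

/-- Membership in `A_{1,σ}`: `f` is entire left monogenic and `sup_x |f(x)| e^{-σ|x|} < ∞`. -/
def MemA {n : ℕ} (σ : ℝ) (f : Para n → Cl n) : Prop :=
  EntireMonogenic f ∧ BddAbove (Set.range fun x => ‖f x‖ * Real.exp (-σ * ‖x‖))

/-- The norm `‖f‖_{1,σ} = sup_x |f(x)| e^{-σ|x|}`. -/
def normA {n : ℕ} (σ : ℝ) (f : Para n → Cl n) : ℝ :=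
  ⨆ x, ‖f x‖ * Real.exp (-σ * ‖x‖)

/-- Convergence of the sequence `f` to `g` in `A₁`. -/
def ConvergesInA {n : ℕ} (f : ℕ → Para n → Cl n) (g : Para n → Cl n) : Prop :=
  ∃ σ : ℝ, 0 < σ ∧ MemA σ g ∧ (∀ N, MemA σ (f N)) ∧
    Tendsto (fun N => normA σ (fun x => f N x - g x)) atTop (𝓝 0)

/-! ### Fueter polynomials and the monogenic exponential -/

/-- The Fueter variable `zᵢ = xᵢ - x₀ eᵢ`. -/
def fueterVar {n : ℕ} (i : Fin n) (x : Para n) : Cl n :=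
  algebraMap ℝ (Cl n) (x i.succ) - x 0 • imUnit i

/-- For a multi-index `m` with `|m| = k`, the distinguishable arrangements `w = (w₁, …, w_k)` of
the indices `1, …, n` in which each `i` appears exactly `mᵢ` times. -/
def arrangements {n : ℕ} (k : ℕ) (m : Fin n → ℕ) : Finset (Fin k → Fin n) :=
  {w | ∀ i, Finset.card {r | w r = i} = m i}

/-- The sum of the ordered products `u_{w₁} ⋯ u_{w_k}` over the distinguishable arrangements. -/
def arrangementSum {n : ℕ} (k : ℕ) (m : Fin n → ℕ) (u : Fin n → Cl n) : Cl n :=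
  ∑ w ∈ arrangements k m, (List.ofFn fun r => u (w r)).prod

/-- The Fueter polynomial `P_m(x) = (m!/|m|!) ∑_w z_{w₁} ⋯ z_{w_{|m|}}`, the sum over the
distinguishable arrangements. Each of these arises from exactly `m!` of the `|m|!` permutations
of `(1, …, 1, …, n, …, n)`, so this is the average of the products `z_{w₁} ⋯ z_{w_{|m|}}` over all
the permutations. -/
def fueterPoly {n : ℕ} (m : Fin n → ℕ) (x : Para n) : Cl n :=
  ((∏ i, ((m i)! : ℝ)) / ((∑ i, m i)! : ℝ)) •
    arrangementSum (∑ i, m i) m (fun i => fueterVar i x)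

/-- `e'_m = ∑_w e_{w₁} ⋯ e_{w_{|m|}}`, the sum over the distinguishable arrangements. -/
def unitSum {n : ℕ} (m : Fin n → ℕ) : Cl n := arrangementSum (∑ i, m i) m imUnit

/-- The monogenic exponential
`E(x) = ∑_k (1/k!) ∑_{|m| = k} P_m(x) e'_m`, the monogenic extension of `e^{x₁e₁ + ⋯ + xₙeₙ}`. -/
def monoExp {n : ℕ} (x : Para n) : Cl n :=
  ∑' k : ℕ, ((k ! : ℝ)⁻¹) •
    ∑ m ∈ Finset.piAntidiag (Finset.univ : Finset (Fin n)) k, fueterPoly m x * unitSum m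

/-! ### Superoscillating sequences -/

/-- The purely imaginary paravector `e₁x₁ + ⋯ + eₙxₙ`. -/
def imVec {n : ℕ} (x : EuclideanSpace ℝ (Fin n)) : Cl n := ∑ i, x i • imUnit i

/-- The exponential `e^y = ∑_k y^k / k!` in `ℝ_n`. -/
def clExp {n : ℕ} (y : Cl n) : Cl n := ∑' k : ℕ, ((k ! : ℝ)⁻¹) • y ^ k

/-- `∑_{j ≤ N} e^{h_j(N) x} Z_j(N)`, `x = e₁x₁ + ⋯ + eₙxₙ`, is a superoscillating sequence:
`|h_j(N)| ≤ 1`, and it converges to `e^{g(a) x}` uniformly on the compact subsets of `ℝⁿ`, where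
`g` is a continuous function with `|g(a)| > 1`. -/
def IsSuperoscillating {n : ℕ} (a : ℝ) (h : ℕ → ℕ → ℝ) (Z : ℕ → ℕ → Cl n) : Prop :=
  (∀ N, ∀ j ≤ N, |h N j| ≤ 1) ∧
  ∃ g : ℝ → ℝ, Continuous g ∧ 1 < |g a| ∧
    ∀ K : Set (EuclideanSpace ℝ (Fin n)), IsCompact K →
      TendstoUniformlyOn
        (fun N x => ∑ j ∈ Finset.range (N + 1), clExp (h N j • imVec x) * Z N j)
        (fun x => clExp (g a • imVec x)) atTop K

end CliffordSupershift

end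

noncomputable section

open MeasureTheory

namespace CliffordSupershift

/-! The sequence is controlled by its moments `∑_j h_j^k Z_j`. On the axis of one unit `e = e_i` the
monogenic exponential is `E(te) = ∑ t^k e^k / k!`, so the Taylor coefficients of `f_N - E(a·)` along
that axis are `e^k (∑_j h_j^k Z_j - a^k) / k!`. Since `e^k` is invertible, the moment defect can be
read off from the `k`-th derivative at the origin. Cauchy estimates on a ball of radius `k`, where
the growth condition costs only `e^{σk}`, bound it by `A q^k ‖f_N - E(a·)‖_{1,σ}`, with `A, q`
independent of `N` (`exists_norm_momentDiff_le`).

An entire monogenic `G` is the sum of its homogeneous parts `G_k`, and these decay faster than any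
geometric sequence, locally uniformly. Hence `F_N(x) - G(ax)` is the sum over `k` of the moment
defect times `G_k(x)` (`EntireMonogenic.hasSum_momentDiff_mul_homPart`), and it is at most a
constant times `‖f_N - E(a·)‖_{1,σ}` on a compact set.

Smoothness, Cauchy estimates and Taylor expansions of `C^1` monogenic functions all come from a mean
value property with a smooth compactly supported radial weight
(`EntireMonogenic.integral_radialWeight_smul`). -/

instance instFiniteDimensionalCl (n : ℕ) : FiniteDimensional ℝ (Cl n) :=
  (cliffordBasis n).finiteDimensional_of_finite

instance instCompleteSpaceCl (n : ℕ) : CompleteSpace (Cl n) := FiniteDimensional.complete ℝ _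

/-- The product of `ℝ_n` as a continuous bilinear map. -/
def mulL (n : ℕ) : Cl n →L[ℝ] Cl n →L[ℝ] Cl n :=
  LinearMap.toContinuousLinearMap
    ((LinearMap.toContinuousLinearMap (𝕜 := ℝ) (E := Cl n) (F' := Cl n)).toLinearMap ∘ₗ
      LinearMap.mul ℝ (Cl n))

@[simp] theorem mulL_apply {n : ℕ} (x y : Cl n) : mulL n x y = x * y := rfl

/-- The Euclidean norm is not submultiplicative for general `n`; the norm of the product map serves
as the constant in every later estimate. -/
theorem norm_mul_le_mulL {n : ℕ} (x y : Cl n) : ‖x * y‖ ≤ ‖mulL n‖ * ‖x‖ * ‖y‖ :=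
  (mulL n).le_opNorm₂ x y

/-! ### Clifford relations and a trace identity -/

theorem imUnit_mul_add_swap {n : ℕ} (i j : Fin n) :
    imUnit i * imUnit j + imUnit j * imUnit i = if i = j then (-2 : Cl n) else 0 := by
  rw [imUnit, imUnit, CliffordAlgebra.ι_mul_ι_add_swap]
  have : QuadraticMap.polar (negSq n) (Pi.single i 1) (Pi.single j 1) =
      if i = j then (-2 : ℝ) else 0 := by
    split_ifs with h
    · subst h
      simp [QuadraticMap.polar, negSq, QuadraticMap.weightedSumSquares_apply, Pi.single_apply,
        mul_add, Finset.sum_add_distrib]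
      norm_num
    · simp [QuadraticMap.polar, negSq, QuadraticMap.weightedSumSquares_apply, Pi.single_apply,
        mul_add, Finset.sum_add_distrib, h, Ne.symm h]
  rw [this]
  split_ifs
  · rw [map_neg, map_ofNat]
  · rw [map_zero]

theorem imUnit_mul_self {n : ℕ} (i : Fin n) : imUnit i * imUnit i = (-1 : Cl n) := by
  have h : negSq n (Pi.single i 1) = -1 := by
    simp [negSq, QuadraticMap.weightedSumSquares_apply, Pi.single_apply]
  rw [imUnit, CliffordAlgebra.ι_sq_scalar, h, map_neg, map_one]

/-- The units `e₀ = 1, e₁, …, eₙ` of the paravector space. -/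
def paraUnit {n : ℕ} : Fin (n + 1) → Cl n := Fin.cons 1 imUnit

/-- The conjugates `1, -e₁, …, -eₙ` of the units of the paravector space. -/
def conjUnit {n : ℕ} : Fin (n + 1) → Cl n := Fin.cons 1 fun i => -imUnit i

theorem conjUnit_mul_paraUnit_add_swap {n : ℕ} (i j : Fin (n + 1)) :
    conjUnit i * paraUnit j + conjUnit j * paraUnit i = if i = j then (2 : Cl n) else 0 := by
  have h2 : (1 : Cl n) + 1 = 2 := by norm_num
  refine Fin.cases ?_ (fun i => ?_) i <;> refine Fin.cases ?_ (fun j => ?_) j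
  · simp [conjUnit, paraUnit, h2]
  · simp [conjUnit, paraUnit, (Fin.succ_ne_zero _).symm]
  · simp [conjUnit, paraUnit]
  · have := imUnit_mul_add_swap i j
    simp only [conjUnit, paraUnit, Fin.cons_succ, neg_mul, Fin.succ_inj]
    rw [← neg_add, this]
    split_ifs <;> simp

theorem cauchyRiemann_eq_sum {n : ℕ} (f : Para n → Cl n) (x : Para n) :
    cauchyRiemann f x = ∑ j, paraUnit j * pderiv j f x := by
  simp [cauchyRiemann, Fin.sum_univ_succ, paraUnit]

/-- Multiply the `i`-th relation by the conjugate unit and sum over `i`; adding the same sum with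
`i` and `j` exchanged leaves twice the trace, by `conjUnit_mul_paraUnit_add_swap`. This replaces the
factorization of the Laplacian when second derivatives of `f` are not available. -/
theorem trace_eq_zero_of_symm {n : ℕ} (I : Fin (n + 1) → Fin (n + 1) → Cl n)
    (hI : ∀ i j, I i j = I j i) (h0 : ∀ i, ∑ j, paraUnit j * I i j = 0) :
    ∑ i, I i i = 0 := by
  have h1 : ∑ i, ∑ j, conjUnit i * paraUnit j * I i j = 0 := by
    simp [mul_assoc, ← Finset.mul_sum, h0]
  have h2 : ∑ i, ∑ j, conjUnit j * paraUnit i * I i j = 0 := by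
    rw [Finset.sum_comm, ← h1]
    exact Finset.sum_congr rfl fun i _ => Finset.sum_congr rfl fun j _ => by rw [hI]
  have h3 : ∑ i, ∑ j, (conjUnit i * paraUnit j + conjUnit j * paraUnit i) * I i j = 0 := by
    simp only [add_mul, Finset.sum_add_distrib, h1, h2, add_zero]
  simp only [conjUnit_mul_paraUnit_add_swap, ite_mul, zero_mul, Finset.sum_ite_eq,
    Finset.mem_univ, if_true, two_mul, Finset.sum_add_distrib] at h3
  rw [← two_smul ℝ, smul_eq_zero] at h3
  exact h3.resolve_left two_ne_zero

/-! ### A radial mean value -/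

/-- The smooth radial function `-g(1 - |y|²)`, where `g(t) = e^{-1/t}` for `t > 0` and `g(t) = 0`
otherwise. -/
def radialPot {n : ℕ} (y : Para n) : ℝ := -expNegInvGlue (1 - ‖y‖ ^ 2)

/-- The radial weight `φ` with `∇ radialPot y = φ(y) y`. -/
def radialWeight {n : ℕ} (y : Para n) : ℝ := 2 * deriv expNegInvGlue (1 - ‖y‖ ^ 2)

theorem contDiff_radialPot {n : ℕ} {k : ℕ∞} : ContDiff ℝ k (radialPot (n := n)) :=
  (expNegInvGlue.contDiff.comp (contDiff_const.sub (contDiff_id.norm_sq ℝ))).neg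

theorem contDiff_deriv_expNegInvGlue {k : ℕ∞} : ContDiff ℝ k (deriv expNegInvGlue) := by
  have h : ContDiff ℝ ((k : WithTop ℕ∞) + 1) expNegInvGlue :=
    (expNegInvGlue.contDiff (n := ⊤)).of_le (by
      exact_mod_cast (le_top : k + 1 ≤ ⊤))
  exact ((contDiff_succ_iff_deriv).1 h).2.2

theorem contDiff_radialWeight {n : ℕ} {k : ℕ∞} : ContDiff ℝ k (radialWeight (n := n)) :=
  contDiff_const.mul
    (contDiff_deriv_expNegInvGlue.comp (contDiff_const.sub (contDiff_id.norm_sq ℝ)))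

theorem hasFDerivAt_radialPot {n : ℕ} (y : Para n) :
    HasFDerivAt radialPot (radialWeight y • innerSL ℝ y) y := by
  have h1 : HasFDerivAt (fun y : Para n => 1 - ‖y‖ ^ 2) (-(2 • innerSL ℝ y)) y :=
    (hasStrictFDerivAt_norm_sq y).hasFDerivAt.const_sub 1
  have h2 : HasDerivAt expNegInvGlue (deriv expNegInvGlue (1 - ‖y‖ ^ 2)) (1 - ‖y‖ ^ 2) :=
    ((expNegInvGlue.contDiff (n := 1)).differentiable (by simp) _).hasDerivAt
  refine (h2.comp_hasFDerivAt y h1).neg.congr_fderiv ?_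
  ext w
  simp [radialWeight]
  ring

theorem fderiv_radialPot_single {n : ℕ} (y : Para n) (i : Fin (n + 1)) :
    fderiv ℝ radialPot y (EuclideanSpace.single i 1) = radialWeight y * y i := by
  rw [(hasFDerivAt_radialPot y).fderiv]
  simp [EuclideanSpace.inner_single_right]

theorem radialPot_eq_zero {n : ℕ} {y : Para n} (hy : y ∉ Metric.closedBall (0 : Para n) 1) :
    radialPot y = 0 := by
  rw [mem_closedBall_zero_iff, not_le] at hy
  rw [radialPot, expNegInvGlue.zero_of_nonpos (by nlinarith), neg_zero]

theorem radialWeight_eq_zero {n : ℕ} {y : Para n}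
    (hy : y ∉ Metric.closedBall (0 : Para n) 1) : radialWeight y = 0 := by
  rw [mem_closedBall_zero_iff, not_le] at hy
  have h : expNegInvGlue =ᶠ[𝓝 (1 - ‖y‖ ^ 2)] fun _ => 0 := by
    filter_upwards [Iio_mem_nhds (by nlinarith : 1 - ‖y‖ ^ 2 < 0)] with t ht
    exact expNegInvGlue.zero_of_nonpos (le_of_lt ht)
  rw [radialWeight, h.deriv_eq]
  simp

theorem hasCompactSupport_radialPot {n : ℕ} : HasCompactSupport (radialPot (n := n)) :=
  HasCompactSupport.intro (isCompact_closedBall 0 1) fun _ hy => radialPot_eq_zero hy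

theorem hasCompactSupport_radialWeight {n : ℕ} : HasCompactSupport (radialWeight (n := n)) :=
  HasCompactSupport.intro (isCompact_closedBall 0 1) fun _ hy => radialWeight_eq_zero hy

theorem radialWeight_nonneg {n : ℕ} (y : Para n) : 0 ≤ radialWeight y :=
  mul_nonneg two_pos.le expNegInvGlue.monotone.deriv_nonneg

/-- The mean value theorem on `[0, 1]` yields a point where the derivative of the glue function is
positive; a vector of the matching length makes the weight nonzero. -/
theorem integral_radialWeight_pos (n : ℕ) : 0 < ∫ y : Para n, radialWeight y := by
  obtain ⟨c, ⟨hc0, hc1⟩, hc⟩ := exists_deriv_eq_slope expNegInvGlue (zero_lt_one' ℝ)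
    (expNegInvGlue.contDiff (n := 0)).continuous.continuousOn
    ((expNegInvGlue.contDiff (n := 1)).differentiable (by simp)).differentiableOn
  have hpos : 0 < deriv expNegInvGlue c := by
    rw [hc, expNegInvGlue.zero]
    simpa using expNegInvGlue.pos_of_pos one_pos
  have hcont : Continuous (radialWeight (n := n)) := (contDiff_radialWeight (k := 0)).continuous
  refine hcont.integral_pos_of_hasCompactSupport_nonneg_nonzero hasCompactSupport_radialWeight
    radialWeight_nonneg (x := EuclideanSpace.single 0 (√(1 - c))) ?_
  have : 1 - ‖(EuclideanSpace.single 0 (√(1 - c)) : Para n)‖ ^ 2 = c := by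
    rw [PiLp.norm_single, Real.norm_eq_abs, sq_abs, Real.sq_sqrt (by linarith)]
    ring
  rw [radialWeight, this]
  positivity

/-! ### Integration by parts and the mean value property -/

theorem integrable_smul_of_hasCompactSupport {n : ℕ} {u : Para n → ℝ} {f : Para n → Cl n}
    (hu : Continuous u) (hc : HasCompactSupport u) (hf : Continuous f) :
    Integrable fun y => u y • f y :=
  (hu.smul hf).integrable_of_hasCompactSupport hc.smul_right

theorem continuous_fderiv_apply_const {n : ℕ} {F : Type*} [NormedAddCommGroup F] [NormedSpace ℝ F]
    {f : Para n → F} (hf : ContDiff ℝ 1 f) (v : Para n) : Continuous fun x => fderiv ℝ f x v :=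
  (hf.continuous_fderiv (by simp)).clm_apply continuous_const

theorem integral_smul_fderiv_eq_neg {n : ℕ} {u : Para n → ℝ} {f : Para n → Cl n}
    (hu : ContDiff ℝ 1 u) (hc : HasCompactSupport u) (hf : ContDiff ℝ 1 f) (v : Para n) :
    ∫ y, u y • fderiv ℝ f y v = -∫ y, fderiv ℝ u y v • f y :=
  integral_smul_fderiv_eq_neg_fderiv_smul_of_integrable
    (integrable_smul_of_hasCompactSupport (continuous_fderiv_apply_const hu v)
      (hc.fderiv_apply ℝ v) hf.continuous)
    (integrable_smul_of_hasCompactSupport hu.continuous hc (continuous_fderiv_apply_const hf v))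
    (integrable_smul_of_hasCompactSupport hu.continuous hc hf.continuous)
    (fun y _ => hu.differentiable (by simp) y) (fun y _ => hf.differentiable (by simp) y)

theorem contDiff_fderiv_apply_const {n : ℕ} {F : Type*} [NormedAddCommGroup F] [NormedSpace ℝ F]
    {f : Para n → F} (hf : ContDiff ℝ 2 f) (v : Para n) : ContDiff ℝ 1 fun x => fderiv ℝ f x v :=
  (hf.fderiv_right (m := 1) (by norm_num)).clm_apply contDiff_const

theorem fderiv_fderiv_apply_comm {n : ℕ} {F : Type*} [NormedAddCommGroup F] [NormedSpace ℝ F]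
    {f : Para n → F} (hf : ContDiff ℝ 2 f) (v w x : Para n) :
    fderiv ℝ (fun y => fderiv ℝ f y v) x w = fderiv ℝ (fun y => fderiv ℝ f y w) x v := by
  have hd : DifferentiableAt ℝ (fderiv ℝ f) x :=
    (hf.fderiv_right (m := 1) (by norm_num)).differentiable (by simp) x
  have hs := hf.contDiffAt.isSymmSndFDerivAt (x := x) (by simp)
  rw [fderiv_clm_apply hd (by fun_prop), fderiv_clm_apply hd (by fun_prop)]
  simpa using hs w v

/-- Both derivatives are moved onto `u`, where they commute, so `f` need only be `C^1`. -/
theorem integral_fderiv_smul_fderiv_comm {n : ℕ} {u : Para n → ℝ} {f : Para n → Cl n}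
    (hu : ContDiff ℝ 2 u) (hc : HasCompactSupport u) (hf : ContDiff ℝ 1 f) (v w : Para n) :
    ∫ y, fderiv ℝ u y v • fderiv ℝ f y w = ∫ y, fderiv ℝ u y w • fderiv ℝ f y v := by
  rw [integral_smul_fderiv_eq_neg (contDiff_fderiv_apply_const hu v) (hc.fderiv_apply ℝ v) hf,
    integral_smul_fderiv_eq_neg (contDiff_fderiv_apply_const hu w) (hc.fderiv_apply ℝ w) hf]
  simp_rw [fderiv_fderiv_apply_comm hu v w]

/-- This is weak harmonicity of `f`: the matrix `∫ ∂_i u ∂_j f` is symmetric and is annihilated by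
the Cauchy-Riemann relation in `j`. -/
theorem EntireMonogenic.sum_integral_pderiv_smul_pderiv {n : ℕ} {f : Para n → Cl n}
    (hf : EntireMonogenic f) {u : Para n → ℝ} (hu : ContDiff ℝ 2 u) (hc : HasCompactSupport u) :
    ∑ i, ∫ y, fderiv ℝ u y (EuclideanSpace.single i 1) • pderiv i f y = 0 := by
  refine trace_eq_zero_of_symm
    (fun i j => ∫ y, fderiv ℝ u y (EuclideanSpace.single i 1) • pderiv j f y)
    (fun i j => integral_fderiv_smul_fderiv_comm hu hc hf.1 _ _) fun i => ?_
  have hint : ∀ j, Integrable fun y =>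
      fderiv ℝ u y (EuclideanSpace.single i 1) • pderiv j f y := fun j =>
    integrable_smul_of_hasCompactSupport (contDiff_fderiv_apply_const hu _).continuous
      (hc.fderiv_apply ℝ _) (continuous_fderiv_apply_const hf.1 _)
  have h1 : ∀ j, paraUnit j * ∫ y, fderiv ℝ u y (EuclideanSpace.single i 1) • pderiv j f y =
      ∫ y, mulL n (paraUnit j) (fderiv ℝ u y (EuclideanSpace.single i 1) • pderiv j f y) :=
    fun j => ((mulL n (paraUnit j)).integral_comp_comm (hint j)).symm
  simp only [h1]
  rw [← integral_finsetSum _ fun j _ => (mulL n (paraUnit j)).integrable_comp (hint j)]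
  refine (integral_congr_ae (Eventually.of_forall fun y => ?_)).trans (integral_zero _ _)
  have h2 := hf.2 y
  rw [cauchyRiemann_eq_sum] at h2
  simp only [map_smul, mulL_apply, ← Finset.smul_sum, h2, smul_zero]

theorem fderiv_comp_add_smul {n : ℕ} {f : Para n → Cl n} (hf : ContDiff ℝ 1 f) (x : Para n)
    (r : ℝ) (y v : Para n) :
    fderiv ℝ (fun y => f (x + r • y)) y v = r • fderiv ℝ f (x + r • y) v := by
  have h1 : HasFDerivAt (fun y : Para n => x + r • y) (r • ContinuousLinearMap.id ℝ (Para n)) y :=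
    ((hasFDerivAt_id y).const_smul r).const_add x
  have h2 := ((hf.differentiable (by simp) (x + r • y)).hasFDerivAt.comp y h1).fderiv
  have h3 : fderiv ℝ (fun y => f (x + r • y)) y = _ := h2
  rw [h3]
  simp

theorem contDiff_comp_add_smul {n : ℕ} {f : Para n → Cl n} {k : WithTop ℕ∞} (hf : ContDiff ℝ k f)
    (x : Para n) (r : ℝ) : ContDiff ℝ k fun y => f (x + r • y) :=
  hf.comp (contDiff_const.add (contDiff_id.const_smul r))

theorem EntireMonogenic.comp_add_smul {n : ℕ} {f : Para n → Cl n} (hf : EntireMonogenic f)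
    (x : Para n) (r : ℝ) : EntireMonogenic fun y => f (x + r • y) := by
  refine ⟨contDiff_comp_add_smul hf.1 x r, fun y => ?_⟩
  have h := hf.2 (x + r • y)
  simp only [cauchyRiemann_eq_sum, pderiv] at h ⊢
  simp only [fderiv_comp_add_smul hf.1, mul_smul_comm, ← Finset.smul_sum, h, smul_zero]

theorem sum_smul_pderiv {n : ℕ} (f : Para n → Cl n) (x y : Para n) :
    ∑ i, y i • pderiv i f x = fderiv ℝ f x y := by
  have h : y = ∑ i, y i • (EuclideanSpace.single i 1 : Para n) := by
    ext j
    simp [Finset.sum_apply, Pi.single_apply]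
  conv_rhs => rw [h]
  simp [pderiv]

/-- As the weight times `y` is the gradient of `radialPot`, the integrand is `∑_i ∂_i u ∂_i f` at `x
+ ry`, and weak harmonicity applies. -/
theorem EntireMonogenic.integral_radialWeight_smul_fderiv {n : ℕ} {f : Para n → Cl n}
    (hf : EntireMonogenic f) (x : Para n) (r : ℝ) :
    ∫ y, radialWeight y • fderiv ℝ f (x + r • y) y = 0 := by
  have hint : ∀ i, Integrable fun y : Para n =>
      fderiv ℝ radialPot y (EuclideanSpace.single i 1) • pderiv i f (x + r • y) := fun i =>
    integrable_smul_of_hasCompactSupport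
      (contDiff_fderiv_apply_const (contDiff_radialPot (k := 2)) _).continuous
      (hasCompactSupport_radialPot.fderiv_apply ℝ _)
      ((continuous_fderiv_apply_const hf.1 _).comp
        (continuous_const.add (continuous_id.const_smul r)))
  have key : ∑ i, ∫ y : Para n, fderiv ℝ radialPot y (EuclideanSpace.single i 1) •
      pderiv i f (x + r • y) = 0 := by
    rcases eq_or_ne r 0 with rfl | hr
    -- For `r = 0` the factor `r` cannot be cancelled; here `∂_i f` is a constant and `∂_i u` has
    -- integral zero.
    · refine Finset.sum_eq_zero fun i _ => ?_
      have h := integral_smul_fderiv_eq_neg (contDiff_radialPot (n := n) (k := 1))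
        hasCompactSupport_radialPot (contDiff_const (c := pderiv i f x))
        (EuclideanSpace.single i 1)
      simp only [zero_smul, add_zero]
      rw [← neg_eq_zero, ← h]
      simp
    · have h := (hf.comp_add_smul x r).sum_integral_pderiv_smul_pderiv
        (contDiff_radialPot (k := 2)) hasCompactSupport_radialPot
      simp only [pderiv, fderiv_comp_add_smul hf.1, smul_comm _ r, integral_smul,
        ← Finset.smul_sum] at h
      exact (smul_eq_zero.1 h).resolve_left hr
  rw [← integral_finsetSum _ fun i _ => hint i] at key
  rw [← key]
  refine integral_congr_ae (Eventually.of_forall fun y => ?_)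
  simp only [fderiv_radialPot_single, mul_smul, ← Finset.smul_sum, sum_smul_pderiv]

theorem hasDerivAt_integral_radialWeight_smul {n : ℕ} {f : Para n → Cl n} (hf : ContDiff ℝ 1 f)
    (x : Para n) (r : ℝ) :
    HasDerivAt (fun r : ℝ => ∫ y, radialWeight y • f (x + r • y))
      (∫ y, radialWeight y • fderiv ℝ f (x + r • y) y) r := by
  have hwc : Continuous (radialWeight (n := n)) := (contDiff_radialWeight (k := 0)).continuous
  -- Restricting to the unit ball lets a constant dominate the derivative.
  have hset : ∀ g : Para n → Cl n, ∫ y, radialWeight y • g y =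
      ∫ y in Metric.closedBall (0 : Para n) 1, radialWeight y • g y := fun g =>
    (setIntegral_eq_integral_of_forall_compl_eq_zero fun y hy => by
      rw [radialWeight_eq_zero hy, zero_smul]).symm
  simp only [hset]
  have hfc : Continuous fun p : ℝ × Para n =>
      radialWeight p.2 • fderiv ℝ f (x + p.1 • p.2) p.2 := by
    refine (hwc.comp continuous_snd).smul (((hf.continuous_fderiv (by simp)).comp ?_).clm_apply
      continuous_snd)
    fun_prop
  obtain ⟨C, hC⟩ := ((isCompact_closedBall r 1).prod
    (isCompact_closedBall (0 : Para n) 1)).exists_bound_of_continuousOn hfc.continuousOn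
  refine (hasDerivAt_integral_of_dominated_loc_of_deriv_le (bound := fun _ => C)
    (F' := fun r y => radialWeight y • fderiv ℝ f (x + r • y) y)
    (Metric.closedBall_mem_nhds r one_pos) ?_ ?_ ?_ ?_ ?_ ?_).2
  · refine Eventually.of_forall fun s => Continuous.aestronglyMeasurable ?_
    exact hwc.smul (hf.continuous.comp (by fun_prop))
  · exact (hwc.smul (hf.continuous.comp (by fun_prop))).continuousOn.integrableOn_compact
      (isCompact_closedBall 0 1)
  · exact (hfc.comp (by fun_prop : Continuous fun y : Para n => (r, y))).aestronglyMeasurable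
  · filter_upwards [ae_restrict_mem Metric.isClosed_closedBall.measurableSet] with y hy s hs
    exact hC (s, y) ⟨hs, hy⟩
  · exact integrableOn_const (isCompact_closedBall (0 : Para n) 1).measure_lt_top.ne
  · refine Eventually.of_forall fun y s _ => ?_
    have h1 : HasDerivAt (fun s : ℝ => x + s • y) y s := by
      simpa using ((hasDerivAt_id s).smul_const y).const_add x
    have h2 : HasDerivAt (fun s : ℝ => f (x + s • y)) (fderiv ℝ f (x + s • y) y) s :=
      (hf.differentiable (by simp) (x + s • y)).hasFDerivAt.comp_hasDerivAt s h1
    exact h2.const_smul (radialWeight y)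

/-- The mean value property of monogenic functions, for the weight `radialWeight`. -/
theorem EntireMonogenic.integral_radialWeight_smul {n : ℕ} {f : Para n → Cl n}
    (hf : EntireMonogenic f) (x : Para n) (r : ℝ) :
    ∫ y, radialWeight y • f (x + r • y) = (∫ y : Para n, radialWeight y) • f x := by
  have hd := hasDerivAt_integral_radialWeight_smul hf.1 x
  have h := is_const_of_deriv_eq_zero (fun r => (hd r).differentiableAt)
    (fun r => by rw [(hd r).deriv, hf.integral_radialWeight_smul_fderiv]) r 0
  simpa [integral_smul_const] using h

theorem radialWeight_neg {n : ℕ} (y : Para n) : radialWeight (-y) = radialWeight y := by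
  simp [radialWeight]

/-! ### Smoothness and Cauchy estimates -/

/-- By the mean value property with `r = 1`, `f` is its own normalized convolution with a smooth
compactly supported weight. -/
theorem EntireMonogenic.contDiff {n : ℕ} {f : Para n → Cl n} (hf : EntireMonogenic f)
    (k : ℕ∞) : ContDiff ℝ k f := by
  have h : ContDiff ℝ k (convolution radialWeight f
      (ContinuousLinearMap.lsmul ℝ ℝ : ℝ →L[ℝ] Cl n →L[ℝ] Cl n) volume) :=
    hasCompactSupport_radialWeight.contDiff_convolution_left _
      contDiff_radialWeight
      hf.1.continuous.locallyIntegrable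
  have h2 : f = fun x => (∫ y : Para n, radialWeight y)⁻¹ •
      convolution radialWeight f
      (ContinuousLinearMap.lsmul ℝ ℝ : ℝ →L[ℝ] Cl n →L[ℝ] Cl n) volume x := by
    funext x
    have h3 : convolution radialWeight f
      (ContinuousLinearMap.lsmul ℝ ℝ : ℝ →L[ℝ] Cl n →L[ℝ] Cl n) volume x =
        ∫ y, radialWeight y • f (x + (1 : ℝ) • y) := by
      rw [convolution_def, ← integral_neg_eq_self]
      simp [radialWeight_neg]
    rw [h3, hf.integral_radialWeight_smul, inv_smul_smul₀ (integral_radialWeight_pos n).ne']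
  rw [h2]
  exact h.const_smul _

/-- The derivative of `f` in the direction `v`. -/
def dirDeriv {n : ℕ} (v : Para n) (f : Para n → Cl n) (x : Para n) : Cl n := fderiv ℝ f x v

theorem EntireMonogenic.entireMonogenic_dirDeriv {n : ℕ} {f : Para n → Cl n}
    (hf : EntireMonogenic f) (v : Para n) :
    EntireMonogenic (dirDeriv v f) := by
  have h2 := hf.contDiff 2
  refine ⟨contDiff_fderiv_apply_const h2 v, fun x => ?_⟩
  rw [cauchyRiemann_eq_sum]
  have hc : ∀ j, pderiv j (dirDeriv v f) x =
      fderiv ℝ (fun y => fderiv ℝ f y (EuclideanSpace.single j 1)) x v := fun j =>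
    fderiv_fderiv_apply_comm h2 v _ x
  simp only [hc]
  have hd : ∀ j, HasFDerivAt (fun y => fderiv ℝ f y (EuclideanSpace.single j 1))
      (fderiv ℝ (fun y => fderiv ℝ f y (EuclideanSpace.single j 1)) x) x := fun j =>
    ((contDiff_fderiv_apply_const h2 _).differentiable (by simp) x).hasFDerivAt
  have hs : HasFDerivAt (fun y => ∑ j, mulL n (paraUnit j)
      (fderiv ℝ f y (EuclideanSpace.single j 1))) _ x :=
    HasFDerivAt.fun_sum fun j _ => (mulL n (paraUnit j)).hasFDerivAt.comp x (hd j)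
  have h0 : (fun y => ∑ j, mulL n (paraUnit j) (fderiv ℝ f y (EuclideanSpace.single j 1))) =
      fun _ => 0 := by
    funext y
    have := hf.2 y
    rwa [cauchyRiemann_eq_sum] at this
  rw [h0] at hs
  have := congrArg (fun l => l v) (hs.unique (hasFDerivAt_const (0 : Cl n) x))
  simpa using this

/-- The constant in the gradient estimate `EntireMonogenic.norm_dirDeriv_le`. -/
def gradConst (n : ℕ) : ℝ :=
  (∫ y : Para n, radialWeight y)⁻¹ * ∫ y : Para n, ‖fderiv ℝ (radialWeight (n := n)) y‖

theorem gradConst_nonneg (n : ℕ) : 0 ≤ gradConst n :=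
  mul_nonneg (inv_nonneg.2 (integral_radialWeight_pos n).le)
    (integral_nonneg fun _ => norm_nonneg _)

/-- Apply the mean value property to the derivative, itself monogenic, and integrate by parts onto
the weight; rescaling by `r` produces the factor `1 / r`. -/
theorem EntireMonogenic.norm_dirDeriv_le {n : ℕ} {f : Para n → Cl n} (hf : EntireMonogenic f)
    (v x : Para n) {r M : ℝ} (hr : 0 < r) (hM : ∀ y ∈ Metric.closedBall x r, ‖f y‖ ≤ M) :
    ‖dirDeriv v f x‖ ≤ gradConst n * ‖v‖ / r * M := by
  have hw1 := contDiff_radialWeight (n := n) (k := 1)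
  have hwd : Continuous (fderiv ℝ (radialWeight (n := n))) := hw1.continuous_fderiv (by simp)
  have hM0 : 0 ≤ M := (norm_nonneg _).trans (hM x (Metric.mem_closedBall_self hr.le))
  have h1 := (hf.entireMonogenic_dirDeriv v).integral_radialWeight_smul x r
  have h2 := integral_smul_fderiv_eq_neg hw1 hasCompactSupport_radialWeight
    (contDiff_comp_add_smul hf.1 x r) v
  simp only [fderiv_comp_add_smul hf.1, smul_comm _ r, integral_smul] at h2
  rw [show ∫ y, radialWeight y • fderiv ℝ f (x + r • y) v = _ from h1] at h2
  have h3 : ‖∫ y, fderiv ℝ radialWeight y v • f (x + r • y)‖ ≤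
      ∫ y : Para n, ‖fderiv ℝ (radialWeight (n := n)) y‖ * (‖v‖ * M) := by
    refine norm_integral_le_of_norm_le ?_ (Eventually.of_forall fun y => ?_)
    · exact (hwd.norm.integrable_of_hasCompactSupport
        (hasCompactSupport_radialWeight.fderiv ℝ).norm).mul_const _
    · by_cases hy : y ∈ Metric.closedBall (0 : Para n) 1
      · rw [norm_smul, ← mul_assoc]
        refine mul_le_mul ((fderiv ℝ radialWeight y).le_opNorm v) (hM _ ?_) (norm_nonneg _)
          (by positivity)
        rw [mem_closedBall_zero_iff] at hy
        rw [mem_closedBall_iff_norm, add_sub_cancel_left, norm_smul, Real.norm_eq_abs,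
          abs_of_pos hr]
        exact mul_le_of_le_one_right hr.le hy
      · have : fderiv ℝ radialWeight y = 0 := by
          have he : (radialWeight (n := n)) =ᶠ[𝓝 y] fun _ => 0 := by
            filter_upwards [Metric.isClosed_closedBall.isOpen_compl.mem_nhds hy] with z hz
            exact radialWeight_eq_zero hz
          rw [he.fderiv_eq]
          simp
        simp [this]
  have hI := integral_radialWeight_pos n
  have h4 := congrArg norm h2
  rw [norm_neg, norm_smul, norm_smul, Real.norm_eq_abs, Real.norm_eq_abs, abs_of_pos hr,
    abs_of_pos hI] at h4
  rw [← h4, integral_mul_const] at h3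
  rw [gradConst, ← mul_le_mul_iff_of_pos_left (mul_pos hr hI), mul_assoc]
  refine h3.trans (le_of_eq ?_)
  field_simp

/-- Cauchy estimates for monogenic functions. -/
theorem EntireMonogenic.norm_iterate_dirDeriv_le {n : ℕ} {f : Para n → Cl n}
    (hf : EntireMonogenic f) (v x : Para n) {r M : ℝ} (hr : 0 < r) (k : ℕ)
    (hM : ∀ y ∈ Metric.closedBall x (k * r), ‖f y‖ ≤ M) :
    ‖(dirDeriv v)^[k] f x‖ ≤ (gradConst n * ‖v‖ / r) ^ k * M := by
  induction k generalizing f M with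
  | zero => simpa using hM x
  | succ k ih =>
    rw [Function.iterate_succ_apply, pow_succ, mul_assoc]
    refine ih (hf.entireMonogenic_dirDeriv v) fun y hy => hf.norm_dirDeriv_le v y hr fun z hz => hM z ?_
    rw [Metric.mem_closedBall] at *
    push_cast
    linarith [dist_triangle z y x]

/-! ### Taylor expansion in homogeneous parts -/

theorem EntireMonogenic.iteratedDeriv_comp_smul {n : ℕ} {f : Para n → Cl n}
    (hf : EntireMonogenic f) (v : Para n) (k : ℕ) :
    iteratedDeriv k (fun t : ℝ => f (t • v)) =
      fun t => (dirDeriv v)^[k] f (t • v) := by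
  induction k generalizing f with
  | zero => simp
  | succ k ih =>
    rw [iteratedDeriv_succ', Function.iterate_succ_apply, ← ih (hf.entireMonogenic_dirDeriv v)]
    congr 1
    funext t
    have h1 : HasDerivAt (fun s : ℝ => s • v) v t := by
      simpa using (hasDerivAt_id t).smul_const v
    exact ((hf.1.differentiable (by simp) (t • v)).hasFDerivAt.comp_hasDerivAt t h1).deriv

theorem EntireMonogenic.iterate_dirDeriv_smul_zero {n : ℕ} {f : Para n → Cl n}
    (hf : EntireMonogenic f) (v : Para n) (k : ℕ) (t : ℝ) :
    (dirDeriv (t • v))^[k] f 0 =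
      t ^ k • (dirDeriv v)^[k] f 0 := by
  have h1 := congrFun (hf.iteratedDeriv_comp_smul (t • v) k) 0
  have h2 := congrFun (hf.iteratedDeriv_comp_smul v k) 0
  have hg : ContDiff ℝ k fun s : ℝ => f (s • v) :=
    (hf.contDiff k).comp (contDiff_id.smul contDiff_const)
  have h3 := congrFun (iteratedDeriv_comp_const_smul hg t) 0
  simp only [mul_zero, zero_smul] at h1 h2 h3
  rw [← h1, ← h2, ← h3]
  simp only [smul_smul, mul_comm]

/-- The homogeneous part of degree `k` of the Taylor series of `f` at the origin. -/
def homPart {n : ℕ} (k : ℕ) (f : Para n → Cl n) (x : Para n) : Cl n :=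
  (k ! : ℝ)⁻¹ • (dirDeriv x)^[k] f 0

theorem EntireMonogenic.homPart_smul {n : ℕ} {f : Para n → Cl n} (hf : EntireMonogenic f)
    (k : ℕ) (t : ℝ) (x : Para n) : homPart k f (t • x) = t ^ k • homPart k f x := by
  rw [homPart, hf.iterate_dirDeriv_smul_zero, smul_comm, homPart]

/-- Spend the radius `R` in `k` steps of length `R / k`; the resulting `k^k` is absorbed by `k^k /
k! ≤ e^k`. -/
theorem EntireMonogenic.norm_iterate_dirDeriv_div_factorial_le {n : ℕ} {f : Para n → Cl n}
    (hf : EntireMonogenic f) (v x : Para n) {R M : ℝ} (hR : 0 < R) (k : ℕ)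
    (hM : ∀ y ∈ Metric.closedBall x R, ‖f y‖ ≤ M) :
    (k ! : ℝ)⁻¹ * ‖(dirDeriv v)^[k] f x‖ ≤ (gradConst n * ‖v‖ * Real.exp 1 / R) ^ k * M := by
  have hM0 : 0 ≤ M := (norm_nonneg _).trans (hM x (Metric.mem_closedBall_self hR.le))
  rcases Nat.eq_zero_or_pos k with rfl | hk
  · simpa using hM x (Metric.mem_closedBall_self hR.le)
  have hk' : (0 : ℝ) < k := by exact_mod_cast hk
  have h1 := hf.norm_iterate_dirDeriv_le v x (div_pos hR hk') k
    (by rwa [mul_div_cancel₀ _ hk'.ne'])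
  have hC := gradConst_nonneg n
  have h2 : ((k ! : ℝ))⁻¹ * (k : ℝ) ^ k ≤ Real.exp 1 ^ k := by
    have := Real.pow_div_factorial_le_exp (k : ℝ) hk'.le k
    rwa [div_eq_inv_mul, ← mul_one (k : ℝ), Real.exp_nat_mul, mul_one] at this
  calc (k ! : ℝ)⁻¹ * ‖(dirDeriv v)^[k] f x‖
      ≤ (k ! : ℝ)⁻¹ * ((gradConst n * ‖v‖ / (R / k)) ^ k * M) := by gcongr
    _ = ((k ! : ℝ)⁻¹ * (k : ℝ) ^ k) * ((gradConst n * ‖v‖ / R) ^ k * M) := by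
        rw [div_div_eq_mul_div, mul_comm _ (k : ℝ), mul_div_assoc, mul_pow]
        ring
    _ ≤ Real.exp 1 ^ k * ((gradConst n * ‖v‖ / R) ^ k * M) := by gcongr
    _ = (gradConst n * ‖v‖ * Real.exp 1 / R) ^ k * M := by
        rw [← mul_assoc, ← mul_pow]
        congr 2
        ring

theorem EntireMonogenic.norm_homPart_le {n : ℕ} {f : Para n → Cl n} (hf : EntireMonogenic f)
    (x : Para n) {R M : ℝ} (hR : 0 < R) (k : ℕ)
    (hM : ∀ y ∈ Metric.closedBall (0 : Para n) R, ‖f y‖ ≤ M) :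
    ‖homPart k f x‖ ≤ (gradConst n * ‖x‖ * Real.exp 1 / R) ^ k * M := by
  rw [homPart, norm_smul, norm_inv, RCLike.norm_natCast]
  exact hf.norm_iterate_dirDeriv_div_factorial_le x 0 hR k hM

theorem Continuous.exists_forall_closedBall_norm_le {n : ℕ} {f : Para n → Cl n}
    (hf : Continuous f) (R : ℝ) : ∃ M, ∀ y ∈ Metric.closedBall (0 : Para n) R, ‖f y‖ ≤ M :=
  (isCompact_closedBall 0 R).exists_bound_of_continuousOn hf.continuousOn

theorem taylorWithinEval_eq_sum_homPart {n : ℕ} {f : Para n → Cl n} (hf : EntireMonogenic f)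
    (v : Para n) (N : ℕ) :
    taylorWithinEval (fun t : ℝ => f (t • v)) N (Set.Icc 0 1) 0 1 =
      ∑ k ∈ Finset.range (N + 1), homPart k f v := by
  rw [taylor_within_apply]
  refine Finset.sum_congr rfl fun k _ => ?_
  have hg : ContDiff ℝ k fun s : ℝ => f (s • v) :=
    (hf.contDiff k).comp (contDiff_id.smul contDiff_const)
  rw [iteratedDerivWithin_eq_iteratedDeriv (uniqueDiffOn_Icc zero_lt_one) hg.contDiffAt (by simp),
    hf.iteratedDeriv_comp_smul]
  simp [homPart]

/-- The Taylor series of an entire monogenic function. -/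
theorem EntireMonogenic.hasSum_homPart {n : ℕ} {f : Para n → Cl n} (hf : EntireMonogenic f)
    (v : Para n) : HasSum (fun k => homPart k f v) (f v) := by
  -- This radius makes the geometric ratio in the Cauchy estimate at most `1 / 2`.
  set R : ℝ := 2 * (gradConst n * ‖v‖ * Real.exp 1) + 1
  have hC := gradConst_nonneg n
  have hA : 0 ≤ gradConst n * ‖v‖ * Real.exp 1 := by positivity
  have hR : 0 < R := by positivity
  have hq0 : 0 ≤ gradConst n * ‖v‖ * Real.exp 1 / R := by positivity
  have hq : gradConst n * ‖v‖ * Real.exp 1 / R ≤ 1 / 2 := by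
    rw [div_le_div_iff₀ hR two_pos]
    simp only [R]
    linarith
  obtain ⟨M, hM⟩ := Continuous.exists_forall_closedBall_norm_le hf.1.continuous (‖v‖ + R)
  have hM0 : 0 ≤ M := (norm_nonneg _).trans (hM 0 (by simp; positivity))
  have hbound : ∀ k, ∀ t ∈ Set.Icc (0 : ℝ) 1,
      (k ! : ℝ)⁻¹ * ‖(dirDeriv v)^[k] f (t • v)‖ ≤ (1 / 2) ^ k * M := fun k t ht => by
    refine (hf.norm_iterate_dirDeriv_div_factorial_le v (t • v) hR k fun y hy => hM y ?_).trans
      (by gcongr)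
    rw [mem_closedBall_iff_norm] at hy
    rw [mem_closedBall_zero_iff]
    have h1 : ‖t • v‖ ≤ ‖v‖ := by
      rw [norm_smul, Real.norm_eq_abs, abs_of_nonneg ht.1]
      exact mul_le_of_le_one_left (norm_nonneg _) ht.2
    linarith [norm_le_norm_add_norm_sub' y (t • v)]
  have hsum : Summable fun k => homPart k f v := by
    refine Summable.of_norm_bounded (g := fun k => (1 / 2 : ℝ) ^ k * M)
      ((summable_geometric_of_lt_one (by norm_num) (by norm_num)).mul_right M) fun k => ?_
    rw [homPart, norm_smul, norm_inv, RCLike.norm_natCast]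
    simpa using hbound k 0 (by simp)
  rw [hsum.hasSum_iff_tendsto_nat, ← tendsto_add_atTop_iff_nat 1, tendsto_iff_norm_sub_tendsto_zero]
  have hlim : Tendsto (fun N : ℕ => ((N + 1 : ℕ) : ℝ) * (1 / 2 : ℝ) ^ (N + 1) * M) atTop (𝓝 0) := by
    have := (tendsto_self_mul_const_pow_of_lt_one (r := (1 / 2 : ℝ)) (by norm_num)
      (by norm_num)).mul_const M
    rw [zero_mul] at this
    exact this.comp (tendsto_add_atTop_nat 1)
  refine squeeze_zero (fun _ => norm_nonneg _) (fun N => ?_) hlim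
  have hg : ContDiff ℝ (N + 1 : ℕ) fun s : ℝ => f (s • v) :=
    (hf.contDiff (N + 1 : ℕ)).comp (contDiff_id.smul contDiff_const)
  -- This remainder bound divides by `N!`, not `(N + 1)!`, hence the extra factor `N + 1` in `hlim`.
  have h := taylor_mean_remainder_bound (f := fun t : ℝ => f (t • v)) (a := 0) (b := 1) (x := 1)
    (n := N) (C := ((N + 1)! : ℝ) * ((1 / 2) ^ (N + 1) * M)) zero_le_one
    (by exact_mod_cast hg.contDiffOn) (by simp) fun t ht => by
      rw [iteratedDerivWithin_eq_iteratedDeriv (uniqueDiffOn_Icc zero_lt_one) hg.contDiffAt ht,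
        hf.iteratedDeriv_comp_smul, ← inv_mul_le_iff₀ (by positivity)]
      exact hbound (N + 1) t ht
  rw [taylorWithinEval_eq_sum_homPart hf, one_smul, norm_sub_rev] at h
  refine h.trans (le_of_eq ?_)
  rw [Nat.factorial_succ]
  push_cast
  field_simp
  simp

theorem eq_zero_of_forall_hasSum_pow_smul_zero {F : Type*} [NormedAddCommGroup F]
    [NormedSpace ℝ F] {c : ℕ → F} (h : ∀ t : ℝ, HasSum (fun k => t ^ k • c k) 0) (k : ℕ) :
    c k = 0 := by
  let p : FormalMultilinearSeries ℝ ℝ F := fun k => ContinuousMultilinearMap.mkPiRing ℝ (Fin k) (c k)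
  have hc : ∀ k, p.coeff k = c k := fun k => by
    simp [p, FormalMultilinearSeries.coeff]
  have hp : HasFPowerSeriesAt (fun _ : ℝ => (0 : F)) p 0 := by
    rw [hasFPowerSeriesAt_iff]
    exact Eventually.of_forall fun t => by simpa [hc] using h t
  have h0 : p = 0 := hp.eq_zero
  rw [← hc, h0]
  simp [FormalMultilinearSeries.coeff]

/-! ### The monogenic exponential on a coordinate axis -/

/-- On a coordinate axis only one Fueter variable survives and it is a real scalar, so the
noncommutative sums over arrangements collapse. -/
theorem fueterVar_smul_single {n : ℕ} (i₀ i : Fin n) (t : ℝ) :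
    fueterVar i (t • (EuclideanSpace.single i₀.succ 1 : Para n)) =
      if i = i₀ then algebraMap ℝ (Cl n) t else 0 := by
  by_cases h : i = i₀
  · simp [fueterVar, h, (Fin.succ_ne_zero _).symm]
  · simp [fueterVar, h, (Fin.succ_ne_zero _).symm]

theorem prod_ofFn_ite {n k : ℕ} (i₀ : Fin n) (b : Cl n) (w : Fin k → Fin n) :
    (List.ofFn fun r => if w r = i₀ then b else 0).prod =
      if w = Function.const _ i₀ then b ^ k else 0 := by
  split_ifs with h
  · simp [h]
  · obtain ⟨r, hr⟩ := Function.ne_iff.1 h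
    refine List.prod_eq_zero (List.mem_ofFn.2 ⟨r, if_neg hr⟩)

theorem const_mem_arrangements {n : ℕ} (k : ℕ) (m : Fin n → ℕ) (i₀ : Fin n) :
    Function.const _ i₀ ∈ arrangements k m ↔ m = Pi.single i₀ k := by
  rw [arrangements, Finset.mem_filter_univ, funext_iff]
  refine forall_congr' fun i => ?_
  by_cases h : i = i₀
  · simp [h, eq_comm]
  · simp [h, Ne.symm h, eq_comm]

theorem arrangements_single {n : ℕ} (k : ℕ) (i₀ : Fin n) :
    arrangements k (Pi.single i₀ k) = {Function.const _ i₀} := by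
  refine Finset.eq_singleton_iff_unique_mem.2
    ⟨(const_mem_arrangements k _ i₀).2 rfl, fun w hw => funext fun r => ?_⟩
  by_contra h
  rw [arrangements, Finset.mem_filter_univ] at hw
  have h1 := hw (w r)
  rw [Pi.single_eq_of_ne (show w r ≠ i₀ from h), Finset.card_eq_zero] at h1
  exact Finset.notMem_empty r (h1 ▸ by simp)

theorem arrangementSum_ite {n : ℕ} (k : ℕ) (m : Fin n → ℕ) (i₀ : Fin n) (b : Cl n) :
    arrangementSum k m (fun i => if i = i₀ then b else 0) =
      if m = Pi.single i₀ k then b ^ k else 0 := by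
  simp only [arrangementSum, prod_ofFn_ite, Finset.sum_ite_eq', const_mem_arrangements]

theorem sum_fueterPoly_mul_unitSum_smul_single {n : ℕ} (i₀ : Fin n) (k : ℕ) (t : ℝ) :
    ∑ m ∈ Finset.piAntidiag (Finset.univ : Finset (Fin n)) k,
      fueterPoly m (t • (EuclideanSpace.single i₀.succ 1 : Para n)) * unitSum m =
      t ^ k • imUnit i₀ ^ k := by
  have hs : ∑ i, (Pi.single i₀ k : Fin n → ℕ) i = k := by simp
  have hp : ∏ i, (((Pi.single i₀ k : Fin n → ℕ) i)! : ℝ) = (k ! : ℝ) := by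
    rw [Finset.prod_eq_single i₀]
    · simp
    · intro i _ hi
      simp [hi]
    · simp
  rw [Finset.sum_eq_single (Pi.single i₀ k)]
  · rw [fueterPoly, unitSum, hs, hp]
    simp only [fueterVar_smul_single, arrangementSum_ite, if_true]
    rw [arrangementSum, arrangements_single, div_self (by positivity), one_smul]
    simp [← map_pow, Algebra.smul_def]
  · intro m hm hne
    rw [fueterPoly]
    simp only [fueterVar_smul_single, arrangementSum_ite, (Finset.mem_piAntidiag.1 hm).1]
    simp [hne]
  · intro h
    exact absurd (Finset.mem_piAntidiag.2 ⟨hs, by simp⟩) h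

theorem norm_pow_le_mulL {n : ℕ} (y : Cl n) (k : ℕ) :
    ‖y ^ k‖ ≤ (‖mulL n‖ * ‖y‖) ^ k * ‖(1 : Cl n)‖ := by
  induction k with
  | zero => simp
  | succ k ih =>
    rw [pow_succ]
    calc ‖y ^ k * y‖ ≤ ‖mulL n‖ * ‖y ^ k‖ * ‖y‖ := norm_mul_le_mulL _ _
      _ ≤ ‖mulL n‖ * ((‖mulL n‖ * ‖y‖) ^ k * ‖(1 : Cl n)‖) * ‖y‖ := by gcongr
      _ = _ := by ring

/-- Only summability needs proof: it ensures that the `tsum` defining `monoExp` is a genuine sum on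
the axis. -/
theorem hasSum_monoExp_smul_single {n : ℕ} (i₀ : Fin n) (t : ℝ) :
    HasSum (fun k : ℕ => (k ! : ℝ)⁻¹ • t ^ k • imUnit i₀ ^ k)
      (monoExp (t • (EuclideanSpace.single i₀.succ 1 : Para n))) := by
  simp only [monoExp, sum_fueterPoly_mul_unitSum_smul_single]
  refine Summable.hasSum (Summable.of_norm_bounded
    (g := fun k => (|t| * (‖mulL n‖ * ‖(imUnit i₀ : Cl n)‖)) ^ k / k ! * ‖(1 : Cl n)‖)
    ((Real.summable_pow_div_factorial _).mul_right _) fun k => ?_)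
  rw [norm_smul, norm_smul, norm_inv, RCLike.norm_natCast, norm_pow, Real.norm_eq_abs]
  calc (k ! : ℝ)⁻¹ * (|t| ^ k * ‖(imUnit i₀ : Cl n) ^ k‖)
      ≤ (k ! : ℝ)⁻¹ * (|t| ^ k * ((‖mulL n‖ * ‖(imUnit i₀ : Cl n)‖) ^ k * ‖(1 : Cl n)‖)) := by
        gcongr
        exact norm_pow_le_mulL _ _
    _ = _ := by
        rw [mul_pow]
        ring

/-! ### Moments of the coefficients -/

theorem hasSum_const_mul {n : ℕ} {f : ℕ → Cl n} {y : Cl n} (hf : HasSum f y) (z : Cl n) :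
    HasSum (fun k => z * f k) (z * y) :=
  hf.mapL (mulL n z)

theorem hasSum_mul_const {n : ℕ} {f : ℕ → Cl n} {y : Cl n} (hf : HasSum f y) (z : Cl n) :
    HasSum (fun k => f k * z) (y * z) :=
  hf.mapL ((mulL n).flip z)

/-- The difference `∑_j h_j^k Z_j - a^k` of the moments of order `k`. -/
def momentDiff {n : ℕ} (a : ℝ) (s : Finset ℕ) (h : ℕ → ℝ) (Z : ℕ → Cl n) (k : ℕ) : Cl n :=
  ∑ j ∈ s, h j ^ k • Z j - a ^ k • 1

theorem hasSum_monoExp_diff {n : ℕ} (a : ℝ) (s : Finset ℕ) (h : ℕ → ℝ) (Z : ℕ → Cl n)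
    (i₀ : Fin n) (t : ℝ) :
    HasSum (fun k : ℕ => t ^ k • (k ! : ℝ)⁻¹ • (imUnit i₀ ^ k * momentDiff a s h Z k))
      (∑ j ∈ s, monoExp (h j • t • (EuclideanSpace.single i₀.succ 1 : Para n)) * Z j -
        monoExp (a • t • (EuclideanSpace.single i₀.succ 1 : Para n))) := by
  have h1 : ∀ j, HasSum
      (fun k : ℕ => ((k ! : ℝ)⁻¹ • (h j * t) ^ k • imUnit i₀ ^ k) * Z j)
      (monoExp (h j • t • (EuclideanSpace.single i₀.succ 1 : Para n)) * Z j) := fun j => by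
    rw [smul_smul]
    exact hasSum_mul_const (hasSum_monoExp_smul_single i₀ (h j * t)) (Z j)
  have h2 := hasSum_monoExp_smul_single i₀ (a * t)
  rw [mul_smul] at h2
  have h3 := (hasSum_sum fun j (_ : j ∈ s) => h1 j).sub h2
  refine cast (congrArg (fun u => HasSum u _) (funext fun k => Eq.symm ?_)) h3
  simp only [momentDiff, mul_sub, Finset.mul_sum, smul_sub, Finset.smul_sum, mul_smul_comm,
    smul_mul_assoc, smul_smul, mul_one, mul_pow]
  congr 1
  · refine Finset.sum_congr rfl fun j _ => ?_
    congr 1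
    ring
  · congr 1
    ring

theorem EntireMonogenic.sub {n : ℕ} {f g : Para n → Cl n} (hf : EntireMonogenic f)
    (hg : EntireMonogenic g) : EntireMonogenic fun x => f x - g x := by
  refine ⟨hf.1.sub hg.1, fun x => ?_⟩
  have h1 := hf.2 x
  have h2 := hg.2 x
  have h3 : fderiv ℝ (fun x => f x - g x) x = fderiv ℝ f x - fderiv ℝ g x :=
    fderiv_fun_sub (hf.1.differentiable (by simp) x) (hg.1.differentiable (by simp) x)
  simp only [cauchyRiemann_eq_sum, pderiv] at h1 h2 ⊢
  simp only [h3, _root_.sub_apply, mul_sub, Finset.sum_sub_distrib, h1, h2, sub_zero]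

theorem MemA.norm_sub_le {n : ℕ} {σ : ℝ} {f g : Para n → Cl n} (hf : MemA σ f) (hg : MemA σ g)
    (x : Para n) : ‖f x - g x‖ ≤ normA σ (fun x => f x - g x) * Real.exp (σ * ‖x‖) := by
  -- Boundedness is required because a real supremum of an unbounded set is `0` by convention.
  have hb : BddAbove (Set.range fun x => ‖f x - g x‖ * Real.exp (-σ * ‖x‖)) := by
    obtain ⟨A, hA⟩ := hf.2
    obtain ⟨B, hB⟩ := hg.2
    refine ⟨A + B, ?_⟩
    rintro _ ⟨y, rfl⟩
    have h1 := hA ⟨y, rfl⟩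
    have h2 := hB ⟨y, rfl⟩
    have h3 := mul_le_mul_of_nonneg_right (_root_.norm_sub_le (f y) (g y)) (Real.exp_pos (-σ * ‖y‖)).le
    dsimp only at h1 h2 ⊢
    linarith
  have h := le_ciSup hb x
  rw [neg_mul, Real.exp_neg, ← div_eq_mul_inv, div_le_iff₀ (Real.exp_pos _)] at h
  exact h

theorem normA_nonneg {n : ℕ} (σ : ℝ) (f : Para n → Cl n) : 0 ≤ normA σ f :=
  Real.iSup_nonneg fun _ => by positivity

/-- The crucial point is that `A` and `q` depend only on `n`, `i₀` and `σ`, so `A₁` convergence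
controls all moments at once, up to geometric growth in `k`. -/
theorem exists_norm_momentDiff_le {n : ℕ} (i₀ : Fin n) {σ : ℝ} (hσ : 0 < σ) :
    ∃ A q : ℝ, 0 ≤ A ∧ 0 ≤ q ∧ ∀ (a : ℝ) (s : Finset ℕ) (h : ℕ → ℝ) (Z : ℕ → Cl n),
      MemA σ (fun x : Para n => ∑ j ∈ s, monoExp (h j • x) * Z j) → MemA σ (fun x : Para n => monoExp (a • x)) →
      ∀ k, ‖momentDiff a s h Z k‖ ≤
        A * q ^ k * normA σ (fun x : Para n => ∑ j ∈ s, monoExp (h j • x) * Z j - monoExp (a • x)) := by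
  set e : Cl n := imUnit i₀
  set v : Para n := EuclideanSpace.single i₀.succ 1
  have hC := gradConst_nonneg n
  refine ⟨‖mulL n‖ * ‖(1 : Cl n)‖,
    (‖mulL n‖ * ‖-e‖) * ((gradConst n * ‖v‖ / 1) * Real.exp σ), by positivity, by positivity,
    fun a s h Z hf hg k => ?_⟩
  set d : Para n → Cl n := fun x : Para n => ∑ j ∈ s, monoExp (h j • x) * Z j - monoExp (a • x)
  have hdm : EntireMonogenic d := hf.1.sub hg.1
  have hcoef : homPart k d v = (k ! : ℝ)⁻¹ • (e ^ k * momentDiff a s h Z k) := by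
    rw [← sub_eq_zero]
    refine eq_zero_of_forall_hasSum_pow_smul_zero
      (c := fun k => homPart k d v - (k ! : ℝ)⁻¹ • (e ^ k * momentDiff a s h Z k)) (fun t => ?_) k
    have h1 := hdm.hasSum_homPart (t • v)
    simp only [hdm.homPart_smul] at h1
    have h2 := h1.sub (hasSum_monoExp_diff a s h Z i₀ t)
    simp only [← smul_sub] at h2
    rwa [show d (t • v) = _ from rfl, sub_self] at h2
  -- The `1 / k!` of the exponential cancels that of Taylor's formula, so no factorial remains.
  have hder : (dirDeriv v)^[k] d 0 = e ^ k * momentDiff a s h Z k :=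
    smul_right_injective _ (inv_ne_zero (by positivity : (k ! : ℝ) ≠ 0)) hcoef
  have hbound : ‖e ^ k * momentDiff a s h Z k‖ ≤
      (gradConst n * ‖v‖ / 1) ^ k * (normA σ d * Real.exp (σ * k)) := by
    -- Steps of fixed length `1` reach radius `k`, where `d` is at most its norm times `e^{σk}`; the
    -- total is geometric in `k`.
    rw [← hder]
    refine hdm.norm_iterate_dirDeriv_le v 0 one_pos k fun y hy => ?_
    rw [mem_closedBall_zero_iff, mul_one] at hy
    refine (hf.norm_sub_le hg y).trans (mul_le_mul_of_nonneg_left ?_ (normA_nonneg _ _))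
    gcongr
  -- Since `e² = -1`, the inverse of `e^k` is `(-e)^k`.
  have hinv : (-e) ^ k * (e ^ k * momentDiff a s h Z k) = momentDiff a s h Z k := by
    rw [← mul_assoc, ← ((Commute.refl e).neg_left).mul_pow, neg_mul, imUnit_mul_self, neg_neg,
      one_pow, one_mul]
  have hN := normA_nonneg σ d
  calc ‖momentDiff a s h Z k‖ = ‖(-e) ^ k * (e ^ k * momentDiff a s h Z k)‖ := by rw [hinv]
    _ ≤ ‖mulL n‖ * ‖(-e) ^ k‖ * ‖e ^ k * momentDiff a s h Z k‖ := norm_mul_le_mulL _ _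
    _ ≤ ‖mulL n‖ * ((‖mulL n‖ * ‖-e‖) ^ k * ‖(1 : Cl n)‖) *
        ((gradConst n * ‖v‖ / 1) ^ k * (normA σ d * Real.exp (σ * k))) := by
        gcongr
        exact norm_pow_le_mulL _ _
    _ = _ := by
        rw [mul_comm σ, Real.exp_nat_mul]
        ring

/-- Homogeneity turns the dilation by `h_j` into the real scalar `h_j^k` on the `k`-th part; being
real, it moves past `Z_j`, which stays on the left. -/
theorem EntireMonogenic.hasSum_momentDiff_mul_homPart {n : ℕ} {G : Para n → Cl n}
    (hG : EntireMonogenic G) (a : ℝ) (s : Finset ℕ) (h : ℕ → ℝ) (Z : ℕ → Cl n) (x : Para n) :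
    HasSum (fun k => momentDiff a s h Z k * homPart k G x)
      (∑ j ∈ s, Z j * G (h j • x) - G (a • x)) := by
  have h1 : ∀ j, HasSum (fun k => Z j * (h j ^ k • homPart k G x)) (Z j * G (h j • x)) :=
    fun j => by
      have h2 := hG.hasSum_homPart (h j • x)
      simp only [hG.homPart_smul] at h2
      exact hasSum_const_mul h2 (Z j)
  have h2 := hG.hasSum_homPart (a • x)
  simp only [hG.homPart_smul] at h2
  have h3 := (hasSum_sum fun j (_ : j ∈ s) => h1 j).sub h2
  refine cast (congrArg (fun u => HasSum u _) (funext fun k => Eq.symm ?_)) h3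
  simp [momentDiff, sub_mul, Finset.sum_mul]

end CliffordSupershift

end

theorem mainTheorem8 {n : ℕ} (hn : 1 ≤ n) (a : ℝ) (ha : 1 < |a|)
    (h : ℕ → ℕ → ℝ) (Z : ℕ → ℕ → CliffordSupershift.Cl n)
    (hsuper : CliffordSupershift.IsSuperoscillating a h Z)
    (hconv : CliffordSupershift.ConvergesInA
      (fun N x => ∑ j ∈ Finset.range (N + 1),
        CliffordSupershift.monoExp (h N j • x) * Z N j)
      (fun x => CliffordSupershift.monoExp (a • x)))
    (G : CliffordSupershift.Para n → CliffordSupershift.Cl n)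
    (hG : CliffordSupershift.EntireMonogenic G) :
    ∀ K : Set (CliffordSupershift.Para n), IsCompact K →
      TendstoUniformlyOn
        (fun N x => ∑ j ∈ Finset.range (N + 1), Z N j * G (h N j • x))
        (fun x => G (a • x)) atTop K := by
  open CliffordSupershift in
  intro K hK
  obtain ⟨σ, hσ, hg, hf, hlim⟩ := hconv
  obtain ⟨A, q, hA, hq, hB⟩ := exists_norm_momentDiff_le (⟨0, hn⟩ : Fin n) hσ
  obtain ⟨ρ, hρ⟩ := hK.isBounded.exists_norm_le
  have hC := gradConst_nonneg n
  -- The Cauchy estimate for `G` on radius `2T + 1` beats `q^k`: the combined ratio `T / (2T + 1)`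
  -- is at most `1 / 2`. The absolute value is needed since `ρ` may be negative when `K` is empty.
  set T : ℝ := q * (gradConst n * |ρ| * Real.exp 1)
  have hT : 0 ≤ T := by positivity
  have hR : 0 < 2 * T + 1 := by positivity
  obtain ⟨M, hM⟩ := Continuous.exists_forall_closedBall_norm_le hG.1.continuous (2 * T + 1)
  have hM0 : 0 ≤ M := (norm_nonneg _).trans (hM 0 (by simpa using hR.le))
  set ε : ℕ → ℝ := fun N => normA σ (fun x => ∑ j ∈ Finset.range (N + 1),
    monoExp (h N j • x) * Z N j - monoExp (a • x))
  have hkey : ∀ N, ∀ x ∈ K, ‖∑ j ∈ Finset.range (N + 1), Z N j * G (h N j • x) - G (a • x)‖ ≤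
      ‖mulL n‖ * A * M * 2 * ε N := fun N x hx => by
    have hε : 0 ≤ ε N := normA_nonneg _ _
    have hx' : ‖x‖ ≤ |ρ| := (hρ x hx).trans (le_abs_self ρ)
    refine (hG.hasSum_momentDiff_mul_homPart a _ (h N) (Z N) x).norm_le_of_bounded
      (g := fun k => ‖mulL n‖ * A * M * (1 / 2) ^ k * ε N)
      ((hasSum_geometric_two.mul_left _).mul_right _) fun k => ?_
    calc ‖momentDiff a (Finset.range (N + 1)) (h N) (Z N) k * homPart k G x‖
        ≤ ‖mulL n‖ * ‖momentDiff a (Finset.range (N + 1)) (h N) (Z N) k‖ * ‖homPart k G x‖ :=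
          norm_mul_le_mulL _ _
      _ ≤ ‖mulL n‖ * (A * q ^ k * ε N) *
          ((gradConst n * |ρ| * Real.exp 1 / (2 * T + 1)) ^ k * M) := by
          gcongr
          · exact hB a _ (h N) (Z N) (hf N) hg k
          · refine (hG.norm_homPart_le x hR k hM).trans ?_
            gcongr
      _ = ‖mulL n‖ * A * M * (T / (2 * T + 1)) ^ k * ε N := by
          rw [show T / (2 * T + 1) = q * (gradConst n * |ρ| * Real.exp 1 / (2 * T + 1)) from
            mul_div_assoc _ _ _, mul_pow]
          ring
      _ ≤ ‖mulL n‖ * A * M * (1 / 2) ^ k * ε N := by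
          have hT2 : T / (2 * T + 1) ≤ 1 / 2 := by
            rw [div_le_div_iff₀ hR two_pos]
            linarith
          exact mul_le_mul_of_nonneg_right (mul_le_mul_of_nonneg_left
            (pow_le_pow_left₀ (by positivity) hT2 k) (by positivity)) hε
  rw [Metric.tendstoUniformlyOn_iff]
  intro δ hδ
  have hlim' : Tendsto (fun N => ‖mulL n‖ * A * M * 2 * ε N) atTop (𝓝 0) := by
    simpa using hlim.const_mul (‖mulL n‖ * A * M * 2)
  filter_upwards [hlim'.eventually_lt_const hδ] with N hN x hx
  rw [dist_comm, dist_eq_norm]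
  exact (hkey N x hx).trans_lt hN
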